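/- Let $n>2$, $\varepsilon_0>0$. A body is a nonempty compact set in $\mathbb{E}^n$ that is the closure of its interior, $B(C,r)$ is the closed ball, $\delta$ is the Hausdorff distance and $d_K$ the diameter. A ball $B(C,r)$, $r>0$, is an outer support ball of a body $K$ if it is disjoint from $\operatorname{int}K$ and meets $\partial K$. The class $\mathcal{K}_3^{\varepsilon_0}$ consists of the bodies $K$ such that every outer support ball of $K$ of radius $r<1/\varepsilon_0$ is contained in an outer support ball of $K$ of radius $1/\varepsilon_0$. For a unit vector $\omega$ let $h_K(\omega)=\max_{x\in K}x\cdot\omega$, $S_K(\omega)=\{x\in K: x\cdot\omega=h_K(\omega)\}$, and let $R_K(\omega)$ be the least radius of a ball $B$ with $K\subseteq B\subseteq\{x:x\cdot\omega\le h_K(\omega)\}$ ($R_K(\omega)=\infty$ if there is none). For a point $C$ and a unit vector $\omega$ let $P(C,\omega)=\{x\ne C:(x-C)\cdot\omega=0\}$, and let $f_{C,\omega}$ be the circular projection onto $P(C,\omega)$, defined off the line through $C$ in direction $\omega$ by $$f_{C,\omega}(x)=C+\frac{\|x-C\|}{\sqrt{\|x-C\|^2-(\omega\cdot(x-C))^2}}\,\bigl[(x-C)-(\omega\cdot(x-C))\,\omega\bigr].$$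 Let $\delta_t(K,L)=\inf_{p\in\mathbb{E}^n}\delta(K+p,L)$ and $\delta_{rC}(K,L)=\inf_\phi\delta(\phi(K),L)$, where $\phi$ runs over all rotations of $\mathbb{E}^n$ about $(n-2)$-dimensional affine subspaces through $C$. Let $K,L\in\mathcal{K}_3^{\varepsilon_0}$ with $d_K,\ d_L,\ \delta(K,L)<1/(2\varepsilon_0)$. Let $\omega_0$ be a unit vector with $R_K(\omega_0)<1/(3\varepsilon_0)$, $S_K(\omega_0)=\{A\}$ and $A\in S_L(\omega_0)$. Let $\mathcal{E}=\mathcal{E}_{\omega_0,A,K,L,\varepsilon_0}$ be the family of all $P(C,\omega)$ (with the chosen centre $C$) that meet both $K$ and $L$, for which $\omega$ is a unit vector in $\operatorname{span}\{\overrightarrow{CA},\ \omega_0^\perp\cap\overrightarrow{CA}^\perp\}$, and for which $B(C,1/\varepsilon_0)$ is an outer support ball of $K$ or of $L$. Let $\varepsilon\ge0$. (a) If $\delta_t(f_{C,\omega}(K),f_{C,\omega}(L))\le\varepsilon$ for all $P(C,\omega)\in\mathcal{E}$, then $$\delta_t(K,L)\le 2\bigl(\sqrt{2R_K(\omega_0)}+\sqrt{\varepsilon}\bigr)\sqrt{\varepsilon}.$$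 (b) For a compact set $M$ and a point $C$ let $r_M(C)$ be the least real $s$ with $M\subseteq B(C,1/\varepsilon_0+s)$, let $R_M(C)$ be the least radius of a ball $B$ with $M\subseteq B\subseteq B(C,1/\varepsilon_0+r_M(C))$, and put $$\tilde\varepsilon_M=(R_M(C)-\varepsilon)\,\alpha\Bigl(1+\frac{R_M(C)-\varepsilon}{4\sqrt{R_M(C)}}\,\alpha\Bigr),\qquad \alpha\ge0,\quad \alpha^2=\frac{\varepsilon_0}{1+\varepsilon_0(r_M(C)-R_M(C))}$$ ($\alpha=0$ if the denominator vanishes). If $\delta_{rC}(f_{C,\omega}(K),f_{C,\omega}(L))\le\varepsilon$ for all $P(C,\omega)\in\mathcal{E}$, then for all $P(C,\omega)\in\mathcal{E}$ and for $M=K$ as well as for $M=f_{C,\omega}(K)$ $$\delta_{rC}(K,L)\le\bigl(\sqrt{8R_K(C)}+3\sqrt{\varepsilon}+\tilde\varepsilon_M\bigr)\sqrt{\varepsilon},$$ and also $\delta_{rC}(K,L)\le\bigl(\sqrt{8R_K(C)}+3\sqrt{\varepsilon+\tilde\varepsilon_M}\bigr)\sqrt{\varepsilon}$ whenever $\tilde\varepsilon_M\ge0$.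 -/

import Mathlib

open Set Metric

noncomputable section

namespace EpsConvex

variable {n : ℕ}

/-- Euclidean `n`-space. -/
abbrev E (n : ℕ) : Type := EuclideanSpace ℝ (Fin n)

/-! ### Bodies and `ε`-convexity -/

/-- A (compact) body: a nonempty compact set that is the closure of its interior. -/
def IsBody (K : Set (E n)) : Prop :=
  IsCompact K ∧ K.Nonempty ∧ closure (interior K) = K

/-- `B(C, r)` is an outer support ball of `K`: it does not meet the interior of `K`, and it
meets `K` at boundary points. -/
def IsOuterSupportBall (K : Set (E n)) (C : E n) (r : ℝ) : Prop :=
  0 < r ∧ Disjoint (closedBall C r) (interior K) ∧ (closedBall C r ∩ frontier K).Nonempty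

/-- The class `𝒦₃^ε`: every outer support ball of `K` of radius `r < 1 / ε` is contained in an
outer support ball of `K` of radius `1 / ε`. -/
def ClassK3 (ε : ℝ) (K : Set (E n)) : Prop :=
  IsBody K ∧ ∀ (x : E n) (r : ℝ), r < 1 / ε → IsOuterSupportBall K x r →
    ∃ C : E n, IsOuterSupportBall K C (1 / ε) ∧ closedBall x r ⊆ closedBall C (1 / ε)

/-! ### Support sets and the support radius in a direction -/

/-- The support function `h_K(ω)`. -/
def supportFun (K : Set (E n)) (ω : E n) : ℝ :=
  sSup ((fun x => inner ℝ x ω) '' K)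

/-- The support half-space `H_K⁺(ω)`, which contains `K`. -/
def supportHalfSpace (K : Set (E n)) (ω : E n) : Set (E n) :=
  {x | inner ℝ x ω ≤ supportFun K ω}

/-- The support set `S_K(ω)`. -/
def supportSet (K : Set (E n)) (ω : E n) : Set (E n) :=
  {x | x ∈ K ∧ inner ℝ x ω = supportFun K ω}

/-- The radii of the balls `B` that support `K` in the direction `ω`: `K ⊆ B ⊆ H_K⁺(ω)`. -/
def supportRadii (K : Set (E n)) (ω : E n) : Set ℝ :=
  {R | ∃ z : E n, K ⊆ closedBall z R ∧ closedBall z R ⊆ supportHalfSpace K ω}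

/-- `R_K(ω)`, the radius of the smallest ball that supports `K` in the direction `ω`. It is
meaningful (finite) when `supportRadii K ω` is nonempty. -/
def supportRadius (K : Set (E n)) (ω : E n) : ℝ :=
  sInf (supportRadii K ω)

/-! ### Translative and rotational Hausdorff distances -/

/-- The translative Hausdorff distance `δ_t(K, L)`. -/
def transDist (K L : Set (E n)) : ℝ :=
  ⨅ p : E n, hausdorffDist ((fun x => x + p) '' K) L

/-- `g` is the linear part of a rotation about an `(n - 2)`-dimensional subspace. -/
def IsAxialRotation (g : E n ≃ₗᵢ[ℝ] E n) : Prop :=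
  LinearMap.det (g.toLinearEquiv : E n →ₗ[ℝ] E n) = 1 ∧
    ∃ F : Submodule ℝ (E n), Module.finrank ℝ F + 2 = n ∧ ∀ x ∈ F, g x = x

/-- The rotational relative to `C` Hausdorff distance `δ_{rC}(K, L)`: the infimum over all
rotations about `(n - 2)`-dimensional affine subspaces through `C`. -/
def rotDist (C : E n) (K L : Set (E n)) : ℝ :=
  ⨅ g : {g : E n ≃ₗᵢ[ℝ] E n // IsAxialRotation g},
    hausdorffDist ((fun x => C + g.1 (x - C)) '' K) L

/-! ### Circular projections -/

/-- The hyperplane `P(C, ω)` through `C` and orthogonal to `ω`, punctured at `C`. -/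
def puncturedPlane (C ω : E n) : Set (E n) :=
  {x | inner ℝ (x - C) ω = 0 ∧ x ≠ C}

/-- The circular projection `f_{C, ω}` onto `P(C, ω)` for a unit vector `ω`: a point `x` off the
line through `C` in direction `ω` goes to the nearest point of `P(C, ω)` on the circle through `x`
with centre `C` in the plane spanned by `x - C` and `ω`. -/
def circProj (C ω x : E n) : E n :=
  C + (‖x - C‖ / Real.sqrt (‖x - C‖ ^ 2 - (inner ℝ ω (x - C)) ^ 2)) •
    ((x - C) - (inner ℝ ω (x - C)) • ω)

/-- The unit vectors in the span of `ω₁` and `ω₀^⊥ ∩ ω₁^⊥`. -/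
def normals (ω₀ ω₁ : E n) : Set (E n) :=
  {ω | ‖ω‖ = 1 ∧
    ω ∈ Submodule.span ℝ {ω₁} ⊔
      ((Submodule.span ℝ {ω₀})ᗮ ⊓ (Submodule.span ℝ {ω₁})ᗮ)}

/-- The punctured hyperplane `P(C, ω)`, with the centre `C` chosen for it, belongs to the family
`ℰ_{ω₀, A, K, L, ε}`. -/
def InFamily (ω₀ A : E n) (K L : Set (E n)) (ε : ℝ) (C ω : E n) : Prop :=
  ω ∈ normals ω₀ (A - C) ∧
    (IsOuterSupportBall K C (1 / ε) ∨ IsOuterSupportBall L C (1 / ε)) ∧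
    (puncturedPlane C ω ∩ K).Nonempty ∧ (puncturedPlane C ω ∩ L).Nonempty

/-! ### Support radii relative to a point -/

/-- `r_M(C)`: the least `s` such that `B(C, 1 / ε + s)` contains `M`. -/
def relHeight (ε : ℝ) (M : Set (E n)) (C : E n) : ℝ :=
  sInf {s : ℝ | M ⊆ closedBall C (1 / ε + s)}

/-- `R_M(C)`: the least radius of a ball `B` with `M ⊆ B ⊆ B(C, 1 / ε + r_M(C))`. -/
def relRadius (ε : ℝ) (M : Set (E n)) (C : E n) : ℝ :=
  sInf {R : ℝ | ∃ z : E n, M ⊆ closedBall z R ∧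
    closedBall z R ⊆ closedBall C (1 / ε + relHeight ε M C)}

/-- The number `α ≥ 0` with `α² = ε₀ / (1 + ε₀ (r_M(C) - R_M(C)))`. -/
def relAlpha (ε₀ : ℝ) (M : Set (E n)) (C : E n) : ℝ :=
  Real.sqrt (ε₀ / (1 + ε₀ * (relHeight ε₀ M C - relRadius ε₀ M C)))

/-- `ε̃ = (R_M(C) - ε) α (1 + (R_M(C) - ε) α / (4 √R_M(C)))`. -/
def epsTilde (ε₀ ε : ℝ) (M : Set (E n)) (C : E n) : ℝ :=
  (relRadius ε₀ M C - ε) * relAlpha ε₀ M C *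
    (1 + (relRadius ε₀ M C - ε) / (4 * Real.sqrt (relRadius ε₀ M C)) * relAlpha ε₀ M C)

end EpsConvex

end

/-!
Write `ρ = 1 / ε₀` and let `A` be the common support point. If `x ∈ K` has distance `d > 0` from
`L`, the ball `B(x, d)` is an outer support ball of `L`, so it lies in an outer support ball
`B(C, ρ)` of `L`: `x` is at depth at least `d` in a ball whose interior misses `L`
(`hausdorffDist_le_of_depth`). As `n > 2`, some unit vector `ω` is orthogonal to `ω₀` and to
`A - C`. The projection `f` with centre `C` and axis `ω` fixes `A`, belongs to the family, and
preserves the distance to `C` on `K` and `L`, so the depth of `x` survives the projection.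

For rotations about `C`, which also preserve the distance to `C`, this gives `d ≤ ε` at once
(`hausdorffDist_le_of_rotDist_le`). The right-hand sides in the rotational part are at least `ε`
since `ε̃ ≥ -√ε` (`neg_sqrt_le_epsTilde`).

For translations it gives `d ≤ ‖p‖ + ε` with a translation `p` that takes `f(K)` to within `ε` of
`f(L)`. The set `f(K)` lies in the ball of radius `R` that touches the support hyperplane of `K` at
`A`, because circular projections map balls centred on their hyperplane that miss `C` into themselves
(`circProj_mem_closedBall`). As `A ∈ f(L)`, this bounds `‖p‖²` by about `2R(⟪p, ω₀⟫ + ε)`, and it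
remains to bound `⟪p, ω₀⟫`, that is, the height of `f(L)` over the support hyperplane. If `C` lies
below that hyperplane then `f` may raise points of `L` over it. The projections centred at
`A + ρ • ω₀` show that `L` nearly lies in a ball of radius `R + ε` touching the hyperplane near `A`
(`exists_translation_of_mem`), so that `L` is narrow near its top. A point of `f(L)` near `A + p` is
then either low, or comes from a point so far from the plane of projection that the projection
brings it close to `A`; in both cases `‖p‖ ≤ √(8Rε) + ε` (`norm_bound_of_approx`).
-/

open Set Metric

namespace EpsConvex

variable {n : ℕ}

/-! ### The estimate for the translation -/

/-- The bound for a translation `p` that moves `f(K)` near `f(L)`, where `f` is a circular projection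
with centre at the origin that fixes the common support point `a`, and `F = f(v)` is the point of
`f(L)` near `a + p`. The vector `q` is the corresponding translation for the centre
`a + ρ • ω₀`, with `v` in the plane of the projection.

If `F` is at most `2ε` above the support hyperplane of `a`, so that `p` points up by at most `3ε`,
the ball around `R • ω₀` gives the bound. If `F` is higher, the stretching factor `t` exceeds `1`
so much that `‖F - a‖² = ‖v - a‖² - 2(t - 1)⟪v, a⟫` is at most `8Rε`. -/
theorem norm_bound_of_approx {V : Type*} [NormedAddCommGroup V] [InnerProductSpace ℝ V]
    {a ω₀ v F p q : V} {t R ε ρ : ℝ} (hω₀ : ‖ω₀‖ = 1) (hR : 0 ≤ R) (hε : 0 ≤ ε) (ht : 1 ≤ t)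
    (hRρ : 3 * R ≤ ρ) (ha : ρ ≤ ‖a‖) (hva : ‖v - a‖ ≤ ρ / 2)
    (hvω : inner ℝ v ω₀ ≤ inner ℝ a ω₀)
    (hF : ‖F‖ = ‖v‖) (hFa : inner ℝ F a = t * inner ℝ v a)
    (hFω : inner ℝ F ω₀ = t * inner ℝ v ω₀)
    (hFp : ‖F - (a + p)‖ ≤ ε) (hp : ‖p - R • ω₀‖ ≤ R + ε)
    (hvq : ‖v - (a + q) + R • ω₀‖ ≤ R + ε) (hq : ‖q - R • ω₀‖ ≤ R + ε)
    (hqω : inner ℝ q ω₀ ≤ ε) :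
    ‖p‖ ≤ √(8 * R * ε) + ε := by
  have hsq : √(8 * R * ε) ^ 2 = 8 * R * ε := Real.sq_sqrt (by positivity)
  have hs0 : 0 ≤ √(8 * R * ε) := Real.sqrt_nonneg _
  -- The ball of radius `R + ε` about `R • ω₀` nearly has its bottom at the origin.
  have key : ∀ w : V, ‖w - R • ω₀‖ ≤ R + ε →
      ‖w‖ ^ 2 ≤ 2 * R * (inner ℝ w ω₀ + ε) + ε ^ 2 := by
    intro w hw
    have h1 : ‖w - R • ω₀‖ ^ 2 ≤ (R + ε) ^ 2 := by gcongr
    rw [@norm_sub_sq ℝ, inner_smul_right, norm_smul, hω₀, Real.norm_of_nonneg hR] at h1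
    simp only [RCLike.re_to_real] at h1
    linarith
  -- For `R ≤ 2ε` the triangle inequality is enough.
  rcases le_total R (2 * ε) with hRε | hRε
  · have h1 : ‖p‖ ≤ ‖p - R • ω₀‖ + ‖R • ω₀‖ := by
      simpa using norm_add_le (p - R • ω₀) (R • ω₀)
    rw [norm_smul, hω₀, Real.norm_of_nonneg hR] at h1
    have h2 : 2 * R ≤ √(8 * R * ε) := Real.le_sqrt_of_sq_le (by nlinarith)
    linarith
  have hFpω : |inner ℝ (F - (a + p)) ω₀| ≤ ε := by
    have := abs_real_inner_le_norm (F - (a + p)) ω₀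
    rw [hω₀, mul_one] at this
    exact this.trans hFp
  rw [inner_sub_left, inner_add_left, abs_le] at hFpω
  rcases le_or_gt (inner ℝ F ω₀ - inner ℝ a ω₀) (2 * ε) with hQ | hQ
  · have h1 := key p hp
    refine abs_le_of_sq_le_sq' ?_ (by positivity) |>.2
    have h2 : inner ℝ p ω₀ ≤ 3 * ε := by linarith [hFpω.1]
    have h3 : 2 * R * (inner ℝ p ω₀ + ε) ≤ 2 * R * (3 * ε + ε) := by gcongr
    have h4 := mul_nonneg hs0 hε
    calc ‖p‖ ^ 2 ≤ 8 * R * ε + ε ^ 2 := by linarith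
      _ ≤ (√(8 * R * ε) + ε) ^ 2 := by rw [add_sq, hsq]; linarith
  -- Both `0` and `v - a` lie in the ball of radius `R + ε` about `q - R • ω₀`, whose top is low.
  · have hva2 : ‖v - a‖ ^ 2 ≤ 4 * R * (inner ℝ a ω₀ - inner ℝ v ω₀) + 16 * R * ε + 4 * ε ^ 2 := by
      have hw : ‖q + (a - v) - R • ω₀‖ ≤ R + ε := by
        have h : v - (a + q) + R • ω₀ = -(q + (a - v) - R • ω₀) := by abel
        rwa [h, norm_neg] at hvq
      have h1 := key _ hw
      have h2 := key q hq
      have h3 := parallelogram_law_with_norm ℝ q (q + (a - v))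
      have h4 : ‖q - (q + (a - v))‖ = ‖v - a‖ := by congr 1; abel
      rw [h4] at h3
      rw [inner_add_left, inner_sub_left] at h1
      have h5 : 0 ≤ ‖q + (q + (a - v))‖ * ‖q + (q + (a - v))‖ := by positivity
      have h6 : R * inner ℝ q ω₀ ≤ R * ε := by gcongr
      nlinarith
    -- `‖v - a‖ ≤ ‖a‖ / 2` gives `⟪v, a⟫ ≥ (√3 / 2) ‖v‖ ‖a‖`, and `√3 / 2 > 5 / 6` while `‖a‖ ≥ 3R`.
    have hinner : 5 / 2 * R * inner ℝ v ω₀ ≤ inner ℝ v a := by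
      have h1 : inner ℝ v ω₀ ≤ ‖v‖ := by
        simpa [hω₀] using real_inner_le_norm v ω₀
      have h2 : ‖v - a‖ ^ 2 ≤ (‖a‖ / 2) ^ 2 := by
        gcongr
        linarith
      rw [@norm_sub_sq ℝ] at h2
      simp only [RCLike.re_to_real] at h2
      have h3 : 5 / 2 * R * inner ℝ v ω₀ ≤ 5 / 2 * R * ‖v‖ := by gcongr
      have h4 : 3 * R * ‖v‖ ≤ ‖a‖ * ‖v‖ := by
        gcongr
        linarith
      nlinarith [sq_nonneg (‖v‖ - 5 / 6 * ‖a‖), sq_nonneg ‖a‖]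
    have hFa2 : ‖F - a‖ ^ 2 = ‖v - a‖ ^ 2 - 2 * ((t - 1) * inner ℝ v a) := by
      rw [@norm_sub_sq ℝ, @norm_sub_sq ℝ]
      simp only [RCLike.re_to_real]
      rw [hF, hFa]
      ring
    have h1 : (t - 1) * (5 / 2 * R * inner ℝ v ω₀) ≤ (t - 1) * inner ℝ v a :=
      mul_le_mul_of_nonneg_left hinner (by linarith)
    have h2 : R * (2 * ε + (inner ℝ a ω₀ - inner ℝ v ω₀)) ≤ R * ((t - 1) * inner ℝ v ω₀) := by
      gcongr
      linarith
    have h3 : ‖F - a‖ ^ 2 ≤ 8 * R * ε := by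
      nlinarith [mul_nonneg hR (sub_nonneg.2 hvω)]
    have h4 : ‖F - a‖ ≤ √(8 * R * ε) := Real.le_sqrt_of_sq_le h3
    calc ‖p‖ = ‖(F - a) - (F - (a + p))‖ := by congr 1; abel
      _ ≤ ‖F - a‖ + ‖F - (a + p)‖ := norm_sub_le _ _
      _ ≤ _ := by gcongr

/-! ### Circular projections -/

/-- Off the axis, the circular projection preserves the distance to the centre and stretches the
component orthogonal to `ω` by a factor `t ≥ 1`. -/
theorem exists_circProj_eq {C ω x : E n} (hω : ‖ω‖ = 1)
    (hx : (inner ℝ ω (x - C)) ^ 2 < ‖x - C‖ ^ 2) :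
    ∃ t : ℝ, 1 ≤ t ∧ ‖circProj C ω x - C‖ = ‖x - C‖ ∧
      ∀ u : E n, inner ℝ u ω = 0 →
        inner ℝ (circProj C ω x - C) u = t * inner ℝ (x - C) u := by
  set v := x - C with hv
  set s := inner ℝ ω v with hs
  have hpos : 0 < ‖v‖ ^ 2 - s ^ 2 := by linarith
  have hsq := Real.sqrt_pos.2 hpos
  have hf : circProj C ω x - C = (‖v‖ / √(‖v‖ ^ 2 - s ^ 2)) • (v - s • ω) := by
    simp [circProj, ← hv, ← hs]
  have hnorm : ‖v - s • ω‖ = √(‖v‖ ^ 2 - s ^ 2) := by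
    rw [eq_comm, Real.sqrt_eq_iff_eq_sq hpos.le (norm_nonneg _),
      @norm_sub_sq ℝ _ _ _ _ v (s • ω), norm_smul, inner_smul_right, real_inner_comm, ← hs, hω]
    simp only [RCLike.re_to_real, Real.norm_eq_abs, mul_one, sq_abs]
    ring
  refine ⟨‖v‖ / √(‖v‖ ^ 2 - s ^ 2), ?_, ?_, ?_⟩
  · rw [one_le_div hsq]
    exact Real.sqrt_le_iff.2 ⟨norm_nonneg _, by nlinarith⟩
  · rw [hf, norm_smul, hnorm, Real.norm_of_nonneg (by positivity), div_mul_cancel₀ _ hsq.ne']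
  · intro u hu
    rw [hf, inner_smul_left, inner_sub_left, inner_smul_left,
      real_inner_comm u ω, hu]
    simp

/-- A vector not orthogonal to some `u ⊥ ω` is not a multiple of `ω`. -/
theorem sq_inner_lt_sq_norm {V : Type*} [NormedAddCommGroup V] [InnerProductSpace ℝ V]
    {ω u v : V} (hω : ‖ω‖ = 1) (hu : inner ℝ u ω = 0) (huv : inner ℝ v u ≠ 0) :
    (inner ℝ ω v) ^ 2 < ‖v‖ ^ 2 := by
  set s := inner ℝ ω v with hs
  have hw : inner ℝ (v - s • ω) u ≠ 0 := by
    rw [inner_sub_left, inner_smul_left, real_inner_comm u ω, hu]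
    simpa using huv
  have hpos : 0 < ‖v - s • ω‖ ^ 2 := by
    have : v - s • ω ≠ 0 := fun h => hw (by rw [h, inner_zero_left])
    positivity
  rw [@norm_sub_sq ℝ, norm_smul, inner_smul_right, real_inner_comm, ← hs, hω] at hpos
  simp only [RCLike.re_to_real, Real.norm_eq_abs, mul_one, sq_abs] at hpos
  linarith

theorem circProj_eq_center_or_norm (C : E n) {ω : E n} (hω : ‖ω‖ = 1) (x : E n) :
    circProj C ω x = C ∨ ‖circProj C ω x - C‖ = ‖x - C‖ := by
  rcases lt_or_ge ((inner ℝ ω (x - C)) ^ 2) (‖x - C‖ ^ 2) with h | h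
  · obtain ⟨t, -, h1, -⟩ := exists_circProj_eq hω h
    exact Or.inr h1
  · left
    rw [circProj, Real.sqrt_eq_zero_of_nonpos (by linarith)]
    simp

theorem circProj_eq_self {C ω x : E n} (hx : inner ℝ (x - C) ω = 0) (hxC : x ≠ C) :
    circProj C ω x = x := by
  have h : 0 < ‖x - C‖ := norm_pos_iff.2 (sub_ne_zero.2 hxC)
  rw [circProj, real_inner_comm, hx]
  simp [Real.sqrt_sq h.le, div_self h.ne']

/-- A ball centred on the hyperplane and not containing `C` is mapped into itself: the projection
increases a positive component along `z - C` and keeps the distance to `C`. -/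
theorem circProj_mem_closedBall {C ω x z : E n} {R : ℝ} (hω : ‖ω‖ = 1)
    (hz : inner ℝ (z - C) ω = 0) (hR : R < ‖z - C‖) (hx : x ∈ closedBall z R) :
    circProj C ω x ∈ closedBall z R := by
  rw [mem_closedBall, dist_eq_norm] at hx ⊢
  have hR0 : 0 ≤ R := (norm_nonneg _).trans hx
  have e1 : x - z = (x - C) - (z - C) := by abel
  have e2 : circProj C ω x - z = (circProj C ω x - C) - (z - C) := by abel
  have h1 := @norm_sub_sq ℝ _ _ _ _ (x - C) (z - C)
  have h2 := @norm_sub_sq ℝ _ _ _ _ (circProj C ω x - C) (z - C)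
  rw [← e1] at h1
  rw [← e2] at h2
  simp only [RCLike.re_to_real] at h1 h2
  have h3 : ‖x - z‖ ^ 2 ≤ R ^ 2 := by gcongr
  have h4 : R ^ 2 < ‖z - C‖ ^ 2 := by gcongr
  have hpos : 0 < inner ℝ (x - C) (z - C) := by nlinarith [sq_nonneg ‖x - C‖]
  obtain ⟨t, ht, hn, ht'⟩ := exists_circProj_eq hω (sq_inner_lt_sq_norm hω hz hpos.ne')
  rw [hn, ht' _ hz] at h2
  have : ‖circProj C ω x - z‖ ^ 2 ≤ R ^ 2 := by nlinarith
  exact (abs_le_of_sq_le_sq' this hR0).2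

theorem isBounded_circProj_image (C : E n) {ω : E n} (hω : ‖ω‖ = 1) {S : Set (E n)}
    (hS : Bornology.IsBounded S) : Bornology.IsBounded (circProj C ω '' S) := by
  obtain ⟨r, hr⟩ := hS.subset_closedBall C
  refine (isBounded_closedBall (x := C) (r := max r 0)).subset ?_
  rintro _ ⟨x, hx, rfl⟩
  rcases circProj_eq_center_or_norm C hω x with h | h
  · rw [h]
    exact mem_closedBall_self (le_max_right _ _)
  · rw [mem_closedBall, dist_eq_norm, h, ← dist_eq_norm]
    exact (mem_closedBall.1 (hr hx)).trans (le_max_left _ _)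

/-! ### Outer support balls -/

theorem IsOuterSupportBall.le_norm_sub {K : Set (E n)} {C : E n} {r : ℝ}
    (h : IsOuterSupportBall K C r) (hK : IsBody K) {y : E n} (hy : y ∈ K) : r ≤ ‖y - C‖ := by
  rw [← dist_eq_norm]
  have hcl : closure (interior K) ⊆ {y | r ≤ dist y C} := by
    refine closure_minimal (fun y hy => ?_) (isClosed_le continuous_const (by fun_prop))
    by_contra hlt
    exact h.2.1.le_bot ⟨mem_closedBall.2 (not_le.1 hlt).le, hy⟩
  rw [hK.2.2] at hcl
  exact hcl hy

/-- The largest ball about an outer point that does not enter `K` is an outer support ball. -/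
theorem isOuterSupportBall_infDist {K : Set (E n)} (hK : IsBody K) {x : E n}
    (hx : 0 < infDist x K) : IsOuterSupportBall K x (infDist x K) := by
  have hint : Disjoint (closedBall x (infDist x K)) (interior K) := by
    rw [Set.disjoint_left]
    intro y hy hyK
    have hd : dist x y = infDist x K :=
      le_antisymm (by rwa [dist_comm]) (infDist_le_dist_of_mem (interior_subset hyK))
    have htend : Filter.Tendsto (fun t : ℝ => AffineMap.lineMap y x t)
        (nhdsWithin 0 (Ioi 0)) (nhds y) := by
      have : Continuous fun t : ℝ => (AffineMap.lineMap y x t : E n) := by fun_prop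
      simpa using (this.tendsto 0).mono_left nhdsWithin_le_nhds
    have hev := (htend.eventually (mem_interior_iff_mem_nhds.1 hyK)).and
      (Ioo_mem_nhdsGT (zero_lt_one' ℝ))
    -- a point of `K` on the segment from `y` to `x`, nearer to `x` than `y`
    obtain ⟨t, htK, ht0, ht1⟩ := hev.exists
    have h1 := infDist_le_dist_of_mem (x := x) htK
    rw [dist_comm, dist_lineMap_right, Real.norm_of_nonneg (by linarith), dist_comm, hd] at h1
    nlinarith
  refine ⟨hx, hint, ?_⟩
  obtain ⟨y, hy, hxy⟩ := hK.1.exists_infDist_eq_dist hK.2.1 x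
  have hmem : y ∈ closedBall x (infDist x K) := by rw [mem_closedBall, dist_comm, hxy]
  exact ⟨y, hmem, subset_closure hy, fun h => hint.le_bot ⟨hmem, h⟩⟩

theorem norm_sub_add_le_of_closedBall_subset {V : Type*} [NormedAddCommGroup V] [NormedSpace ℝ V]
    {x C : V} {d r : ℝ} (hd : 0 ≤ d) (hdr : d ≤ r) (h : closedBall x d ⊆ closedBall C r) :
    ‖x - C‖ + d ≤ r := by
  rcases eq_or_ne x C with rfl | hne
  · simpa using hdr
  have h0 : 0 < ‖x - C‖ := norm_pos_iff.2 (sub_ne_zero.2 hne)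
  have hm : x + (d / ‖x - C‖) • (x - C) ∈ closedBall x d := by
    rw [mem_closedBall, dist_eq_norm, add_sub_cancel_left, norm_smul,
      Real.norm_of_nonneg (by positivity), div_mul_cancel₀ _ h0.ne']
  have h1 := h hm
  have e : x + (d / ‖x - C‖) • (x - C) - C = (1 + d / ‖x - C‖) • (x - C) := by
    rw [add_smul, one_smul]
    abel
  rw [mem_closedBall, dist_eq_norm, e, norm_smul, Real.norm_of_nonneg (by positivity), add_mul,
    one_mul, div_mul_cancel₀ _ h0.ne'] at h1
  exact h1

/-- A point outside `K` lies in an outer support ball of radius `1 / ε₀`, at a depth at least its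
distance from `K`. -/
theorem ClassK3.exists_center {ε₀ : ℝ} {K : Set (E n)} (hK : ClassK3 ε₀ K)
    {x : E n} (hx : 0 < infDist x K) (hx' : infDist x K < 1 / ε₀) :
    ∃ C, IsOuterSupportBall K C (1 / ε₀) ∧ ‖x - C‖ + infDist x K ≤ 1 / ε₀ := by
  obtain ⟨C, hC, hsub⟩ := hK.2 x _ hx' (isOuterSupportBall_infDist hK.1 hx)
  exact ⟨C, hC, norm_sub_add_le_of_closedBall_subset hx.le hx'.le hsub⟩

theorem exists_unit_orthogonal (hn : 2 < n) (u v : E n) :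
    ∃ ω : E n, ‖ω‖ = 1 ∧ inner ℝ u ω = 0 ∧ inner ℝ v ω = 0 := by
  set F : Submodule ℝ (E n) := Submodule.span ℝ {u, v}
  have h1 : Module.finrank ℝ F ≤ 2 := by
    classical
    have := finrank_span_finset_le_card (R := ℝ) ({u, v} : Finset (E n))
    simp only [Finset.coe_insert, Finset.coe_singleton] at this
    exact this.trans Finset.card_le_two
  have h2 := F.finrank_add_finrank_orthogonal
  rw [finrank_euclideanSpace_fin] at h2
  have h3 : Fᗮ ≠ ⊥ := by
    intro h
    rw [h, finrank_bot] at h2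
    omega
  obtain ⟨w, hw, hw0⟩ := Submodule.exists_mem_ne_zero_of_ne_bot h3
  have hw' := F.mem_orthogonal w |>.1 hw
  refine ⟨(‖w‖⁻¹ : ℝ) • w, norm_smul_inv_norm hw0, ?_, ?_⟩
  · rw [inner_smul_right, hw' u (Submodule.subset_span (by simp)), mul_zero]
  · rw [inner_smul_right, hw' v (Submodule.subset_span (by simp)), mul_zero]

/-- Normals orthogonal to both `ω₀` and `A - C` are admissible; the projection then fixes `A`. -/
theorem inFamily_of_orthogonal {ω₀ A C ω : E n} {K L : Set (E n)} {ε₀ : ℝ} (hω : ‖ω‖ = 1)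
    (hω₀ : inner ℝ ω₀ ω = 0) (hωA : inner ℝ (A - C) ω = 0) (hAC : A ≠ C) (hAK : A ∈ K)
    (hAL : A ∈ L) (hC : IsOuterSupportBall K C (1 / ε₀) ∨ IsOuterSupportBall L C (1 / ε₀)) :
    InFamily ω₀ A K L ε₀ C ω := by
  refine ⟨⟨hω, Submodule.mem_sup_right ⟨?_, ?_⟩⟩, hC, ⟨A, ⟨hωA, hAC⟩, hAK⟩, ⟨A, ⟨hωA, hAC⟩, hAL⟩⟩
  · exact Submodule.mem_orthogonal_singleton_iff_inner_right.2 hω₀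
  · exact Submodule.mem_orthogonal_singleton_iff_inner_right.2 hωA

/-! ### Hausdorff distances -/

theorem exists_translation_of_transDist_lt {S T : Set (E n)} {ε : ℝ}
    (hS : Bornology.IsBounded S) (hT : Bornology.IsBounded T) (hS' : S.Nonempty)
    (hT' : T.Nonempty) (h : transDist S T < ε) :
    ∃ p : E n, (∀ x ∈ S, ∃ y ∈ T, ‖x + p - y‖ < ε) ∧ ∀ y ∈ T, ∃ x ∈ S, ‖x + p - y‖ < ε := by
  obtain ⟨p, hp⟩ := exists_lt_of_ciInf_lt h
  have hfin : hausdorffEDist ((fun x => x + p) '' S) T ≠ ⊤ := by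
    refine hausdorffEDist_ne_top_of_nonempty_of_bounded (hS'.image _) hT' ?_ hT
    exact (LipschitzWith.isBounded_image (K := 1) (LipschitzWith.of_dist_le_mul (by simp)) hS)
  refine ⟨p, fun x hx => ?_, fun y hy => ?_⟩
  · obtain ⟨y, hy, h1⟩ := exists_dist_lt_of_hausdorffDist_lt (mem_image_of_mem _ hx) hp hfin
    exact ⟨y, hy, by rwa [dist_eq_norm] at h1⟩
  · obtain ⟨_, ⟨x, hx, rfl⟩, h1⟩ := exists_dist_lt_of_hausdorffDist_lt' hy hp hfin
    exact ⟨x, hx, by rwa [dist_eq_norm] at h1⟩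

theorem isAxialRotation_refl (hn : 2 ≤ n) : IsAxialRotation (LinearIsometryEquiv.refl ℝ (E n)) := by
  refine ⟨?_, ?_⟩
  · exact LinearMap.det_id
  · obtain ⟨k, rfl⟩ := Nat.exists_eq_add_of_le hn
    have h : k ≤ Module.finrank ℝ (E (2 + k)) := by simp
    obtain ⟨f, hf⟩ := exists_linearIndependent_of_le_finrank h
    refine ⟨Submodule.span ℝ (range f), ?_, fun x _ => rfl⟩
    rw [finrank_span_eq_card hf, Fintype.card_fin, add_comm]

theorem exists_isometry_of_rotDist_lt (hn : 2 ≤ n) {C : E n} {S T : Set (E n)} {ε : ℝ}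
    (hS : Bornology.IsBounded S) (hT : Bornology.IsBounded T) (hS' : S.Nonempty)
    (hT' : T.Nonempty) (h : rotDist C S T < ε) :
    ∃ g : E n ≃ₗᵢ[ℝ] E n, (∀ x ∈ S, ∃ y ∈ T, ‖C + g (x - C) - y‖ < ε) ∧
      ∀ y ∈ T, ∃ x ∈ S, ‖C + g (x - C) - y‖ < ε := by
  have : Nonempty {g : E n ≃ₗᵢ[ℝ] E n // IsAxialRotation g} := ⟨_, isAxialRotation_refl hn⟩
  obtain ⟨g, hg⟩ := exists_lt_of_ciInf_lt h
  have hfin : hausdorffEDist ((fun x => C + g.1 (x - C)) '' S) T ≠ ⊤ := by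
    refine hausdorffEDist_ne_top_of_nonempty_of_bounded (hS'.image _) hT' ?_ hT
    exact (LipschitzWith.isBounded_image (K := 1)
      (LipschitzWith.of_dist_le_mul fun x y => by simp) hS)
  refine ⟨g.1, fun x hx => ?_, fun y hy => ?_⟩
  · obtain ⟨y, hy, h1⟩ := exists_dist_lt_of_hausdorffDist_lt (mem_image_of_mem _ hx) hg hfin
    exact ⟨y, hy, by rwa [dist_eq_norm] at h1⟩
  · obtain ⟨_, ⟨x, hx, rfl⟩, h1⟩ := exists_dist_lt_of_hausdorffDist_lt' hy hg hfin
    exact ⟨x, hx, by rwa [dist_eq_norm] at h1⟩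

theorem transDist_le_hausdorffDist (K L : Set (E n)) : transDist K L ≤ hausdorffDist K L := by
  have h := ciInf_le (f := fun p : E n => hausdorffDist ((fun x => x + p) '' K) L)
    ⟨0, by rintro _ ⟨p, rfl⟩; exact hausdorffDist_nonneg⟩ 0
  simpa [transDist] using h

theorem rotDist_le_hausdorffDist (hn : 2 ≤ n) (C : E n) (K L : Set (E n)) :
    rotDist C K L ≤ hausdorffDist K L := by
  have h := ciInf_le
    (f := fun g : {g : E n ≃ₗᵢ[ℝ] E n // IsAxialRotation g} =>
      hausdorffDist ((fun x => C + g.1 (x - C)) '' K) L)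
    ⟨0, by rintro _ ⟨p, rfl⟩; exact hausdorffDist_nonneg⟩ ⟨_, isAxialRotation_refl hn⟩
  simpa [rotDist] using h

/-! ### Support sets and support balls -/

theorem inner_le_supportFun {K : Set (E n)} (hK : IsCompact K) (ω : E n) {x : E n} (hx : x ∈ K) :
    inner ℝ x ω ≤ supportFun K ω :=
  le_csSup (hK.image (by fun_prop)).bddAbove (mem_image_of_mem _ hx)

theorem inner_lt_supportFun_of_mem_interior {K : Set (E n)} (hK : IsCompact K) {ω : E n}
    (hω : ‖ω‖ = 1) {x : E n} (hx : x ∈ interior K) : inner ℝ x ω < supportFun K ω := by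
  obtain ⟨δ, hδ, hball⟩ := Metric.isOpen_iff.1 isOpen_interior x hx
  have hmem : x + (δ / 2) • ω ∈ K := by
    refine interior_subset (hball ?_)
    rw [mem_ball, dist_eq_norm, add_sub_cancel_left, norm_smul, hω, mul_one,
      Real.norm_of_nonneg (by positivity)]
    linarith
  have h := inner_le_supportFun hK ω hmem
  rw [inner_add_left, inner_smul_left, real_inner_self_eq_norm_sq, hω] at h
  simp only [RCLike.conj_to_real] at h
  linarith

/-- A ball lying above a support hyperplane and touching it at a point of the body is an outer
support ball. -/
theorem isOuterSupportBall_of_mem_supportSet {K : Set (E n)} (hK : IsCompact K) {ω A : E n}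
    (hω : ‖ω‖ = 1) (hA : A ∈ supportSet K ω) {r : ℝ} (hr : 0 < r) :
    IsOuterSupportBall K (A + r • ω) r := by
  refine ⟨hr, ?_, A, ?_, subset_closure hA.1, fun h => ?_⟩
  · rw [Set.disjoint_left]
    intro y hy hyK
    have h1 := inner_lt_supportFun_of_mem_interior hK hω hyK
    rw [mem_closedBall, dist_eq_norm] at hy
    have h2 := (abs_le.1 ((abs_real_inner_le_norm (y - (A + r • ω)) ω))).1
    rw [hω, mul_one, inner_sub_left, inner_add_left, inner_smul_left, real_inner_self_eq_norm_sq,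
      hω, hA.2] at h2
    simp only [RCLike.conj_to_real] at h2
    linarith
  · rw [mem_closedBall, dist_eq_norm, sub_add_cancel_left, norm_neg, norm_smul, hω, mul_one,
      Real.norm_of_nonneg hr.le]
  · exact (inner_lt_supportFun_of_mem_interior hK hω h).ne hA.2

/-- A ball that supports `K` in the direction `ω` touches the support hyperplane at each point of
the support set. -/
theorem subset_closedBall_of_mem_supportRadii {K : Set (E n)} {ω A : E n} {R : ℝ} (hω : ‖ω‖ = 1)
    (hA : A ∈ supportSet K ω) (hR : R ∈ supportRadii K ω) :
    0 ≤ R ∧ K ⊆ closedBall (A - R • ω) R := by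
  obtain ⟨z, hKz, hz⟩ := hR
  have hAz := hKz hA.1
  rw [mem_closedBall, dist_eq_norm] at hAz
  have hR0 : 0 ≤ R := (norm_nonneg _).trans hAz
  have htop : z + R • ω ∈ closedBall z R := by
    rw [mem_closedBall, dist_eq_norm, add_sub_cancel_left, norm_smul, hω, mul_one,
      Real.norm_of_nonneg hR0]
  have h1 : inner ℝ (z + R • ω) ω ≤ inner ℝ A ω := (hz htop).trans_eq hA.2.symm
  rw [inner_add_left, inner_smul_left, real_inner_self_eq_norm_sq, hω] at h1
  simp only [RCLike.conj_to_real] at h1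
  have h2 : ‖(A - z) - R • ω‖ ^ 2 ≤ 0 := by
    rw [@norm_sub_sq ℝ, norm_smul, hω, inner_smul_right, inner_sub_left, mul_one,
      Real.norm_of_nonneg hR0]
    simp only [RCLike.re_to_real]
    have : ‖A - z‖ ^ 2 ≤ R ^ 2 := by gcongr
    nlinarith
  have h3 : A - z - R • ω = 0 := by
    rw [← norm_eq_zero]
    exact pow_eq_zero_iff two_ne_zero |>.1 (le_antisymm h2 (sq_nonneg _))
  have h4 : A - R • ω = z := by rw [← sub_eq_zero, ← h3]; abel
  exact ⟨hR0, h4 ▸ hKz⟩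

/-! ### Bounds for the Hausdorff distance from translations -/

/-- The hypothesis at the centre `C = A + ρ • ω₀` of the ball that touches both bodies at `A` from
above: each `v ∈ L`, and `A` itself, lies in the ball of radius `R + ε` about `A + q - R • ω₀` for
a vector `q`, possibly depending on `v`, that points up by at most `ε`. Seen from there, circular
projections move points of `L` down, and `n > 2` leaves room for a projection that fixes `v`. -/
theorem exists_translation_of_mem (hn : 2 < n) {ε₀ : ℝ} (hε₀ : 0 < ε₀) {K L : Set (E n)}
    (hK : IsBody K) (hL : IsBody L) {ω₀ A : E n} (hω₀ : ‖ω₀‖ = 1)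
    (hAK : A ∈ supportSet K ω₀) (hAL : A ∈ supportSet L ω₀) {R ε : ℝ}
    (hR : R ∈ supportRadii K ω₀)
    (h : ∀ C ω : E n, InFamily ω₀ A K L ε₀ C ω →
      transDist (circProj C ω '' K) (circProj C ω '' L) < ε) {v : E n} (hv : v ∈ L) :
    ∃ q : E n, ‖v - (A + q) + R • ω₀‖ ≤ R + ε ∧ ‖q - R • ω₀‖ ≤ R + ε ∧ inner ℝ q ω₀ ≤ ε := by
  obtain ⟨hR0, hKR⟩ := subset_closedBall_of_mem_supportRadii hω₀ hAK hR
  set ρ := 1 / ε₀ with hρ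
  have hρ0 : 0 < ρ := by positivity
  set C := A + ρ • ω₀ with hCdef
  have hAC : A - C = -(ρ • ω₀) := by rw [hCdef]; abel
  have hCL := isOuterSupportBall_of_mem_supportSet hL.1 hω₀ hAL hρ0
  rw [← hCdef] at hCL
  obtain ⟨ω, hω, hω₀ω, hvω⟩ := exists_unit_orthogonal hn ω₀ (v - C)
  have hAω : inner ℝ (A - C) ω = 0 := by rw [hAC, inner_neg_left, inner_smul_left, hω₀ω]; simp
  have hACne : A ≠ C := fun h => by
    have := hCL.le_norm_sub hL hAL.1
    rw [h, sub_self, norm_zero] at this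
    linarith
  have hvC : v ≠ C := fun h => by
    have := hCL.le_norm_sub hL hv
    rw [h, sub_self, norm_zero] at this
    linarith
  have hfA := circProj_eq_self hAω hACne
  have hfv := circProj_eq_self hvω hvC
  obtain ⟨q, hq1, hq2⟩ := exists_translation_of_transDist_lt
    (isBounded_circProj_image C hω hK.1.isBounded) (isBounded_circProj_image C hω hL.1.isBounded)
    (hK.2.1.image _) (hL.2.1.image _)
    (h C ω (inFamily_of_orthogonal hω hω₀ω hAω hACne hAK.1 hAL.1 (Or.inr hCL)))
  have hz : A - R • ω₀ - C = (-(R + ρ)) • ω₀ := by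
    rw [hCdef, neg_smul, add_smul]
    abel
  have hball : ∀ y ∈ L, circProj C ω y = y → ‖y - (A + q) + R • ω₀‖ ≤ R + ε := by
    intro y hy hfy
    obtain ⟨_, ⟨k, hk, rfl⟩, hk'⟩ := hq2 _ (mem_image_of_mem _ hy)
    rw [hfy] at hk'
    have h1 : circProj C ω k ∈ closedBall (A - R • ω₀) R := by
      refine circProj_mem_closedBall hω ?_ ?_ (hKR hk)
      · rw [hz, inner_smul_left, hω₀ω, mul_zero]
      · rw [hz, norm_smul, hω₀, norm_neg, Real.norm_of_nonneg (by positivity)]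
        linarith
    rw [mem_closedBall, dist_eq_norm] at h1
    calc ‖y - (A + q) + R • ω₀‖
        = ‖(circProj C ω k - (A - R • ω₀)) - (circProj C ω k + q - y)‖ := by congr 1; abel
      _ ≤ _ := (norm_sub_le _ _).trans (add_le_add h1 hk'.le)
  refine ⟨q, hball v hv hfv, ?_, ?_⟩
  · have h1 := hball A hAL.1 hfA
    rwa [← norm_neg, show -(A - (A + q) + R • ω₀) = q - R • ω₀ by abel] at h1
  · obtain ⟨_, ⟨l, hl, rfl⟩, hl'⟩ := hq1 _ (mem_image_of_mem _ hAK.1)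
    rw [hfA] at hl'
    have hlC : inner ℝ (l - C) (A - C) = -ρ * (inner ℝ l ω₀ - inner ℝ A ω₀ - ρ) := by
      rw [hAC, hCdef, inner_neg_right, inner_smul_right, inner_sub_left, inner_add_left,
        inner_smul_left, real_inner_self_eq_norm_sq, hω₀]
      simp only [RCLike.conj_to_real]
      ring
    have hlh : inner ℝ l ω₀ ≤ inner ℝ A ω₀ := (inner_le_supportFun hL.1 ω₀ hl).trans_eq hAL.2.symm
    have hpos : 0 < inner ℝ (l - C) (A - C) := by
      rw [hlC]
      nlinarith
    obtain ⟨t, ht, -, ht'⟩ := exists_circProj_eq hω (sq_inner_lt_sq_norm hω hAω hpos.ne')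
    have h1 := ht' ω₀ hω₀ω
    have h2 : inner ℝ (circProj C ω l) ω₀ ≤ inner ℝ A ω₀ := by
      have h3 : inner ℝ C ω₀ = inner ℝ A ω₀ + ρ := by
        rw [hCdef, inner_add_left, inner_smul_left, real_inner_self_eq_norm_sq, hω₀]
        simp
      rw [inner_sub_left, inner_sub_left, h3] at h1
      nlinarith
    have h3 := (abs_real_inner_le_norm (A + q - circProj C ω l) ω₀)
    rw [hω₀, mul_one, inner_sub_left, inner_add_left] at h3
    linarith [le_abs_self (inner ℝ A ω₀ + inner ℝ q ω₀ - inner ℝ (circProj C ω l) ω₀)]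

/-- A set of small diameter through `A` lies well off the axis of a circular projection whose
hyperplane contains `A`. -/
theorem inner_pos_of_diam_le {M : Set (E n)} (hM : Bornology.IsBounded M) {ρ : ℝ} (hρ : 0 < ρ)
    (hd : Metric.diam M ≤ ρ / 2) {A C : E n} (hA : A ∈ M) (hAC : ρ ≤ ‖A - C‖) {x : E n}
    (hx : x ∈ M) : 0 < inner ℝ (x - C) (A - C) := by
  have h0 : ‖(x - C) - (A - C)‖ ≤ ‖A - C‖ / 2 := by
    rw [sub_sub_sub_cancel_right, ← dist_eq_norm]
    linarith [dist_le_diam_of_mem hM hx hA]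
  have h1 : ‖(x - C) - (A - C)‖ ^ 2 ≤ (‖A - C‖ / 2) ^ 2 := by gcongr
  rw [@norm_sub_sq ℝ] at h1
  simp only [RCLike.re_to_real] at h1
  nlinarith [sq_nonneg ‖x - C‖]

theorem norm_circProj_sub_of_diam_le {M : Set (E n)} (hM : Bornology.IsBounded M) {ρ : ℝ}
    (hρ : 0 < ρ) (hd : Metric.diam M ≤ ρ / 2) {A C ω : E n} (hA : A ∈ M) (hAC : ρ ≤ ‖A - C‖)
    (hω : ‖ω‖ = 1) (hAω : inner ℝ (A - C) ω = 0) {x : E n} (hx : x ∈ M) :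
    ‖circProj C ω x - C‖ = ‖x - C‖ := by
  obtain ⟨t, -, hnorm, -⟩ := exists_circProj_eq hω
    (sq_inner_lt_sq_norm hω hAω (inner_pos_of_diam_le hM hρ hd hA hAC hx).ne')
  exact hnorm

/-- At the centre `C` of any outer support ball of one of the bodies, some circular projection `f`
that preserves the distance to `C` on both bodies takes `K` near to `L` up to a short translation. -/
theorem exists_short_translation (hn : 2 < n) {ε₀ : ℝ} (hε₀ : 0 < ε₀) {K L : Set (E n)}
    (hK : IsBody K) (hL : IsBody L) (hdK : Metric.diam K ≤ 1 / (2 * ε₀))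
    (hdL : Metric.diam L ≤ 1 / (2 * ε₀)) {ω₀ A : E n}
    (hω₀ : ‖ω₀‖ = 1) (hAK : A ∈ supportSet K ω₀) (hAL : A ∈ supportSet L ω₀) {R ε : ℝ}
    (hε : 0 ≤ ε) (hR : R ∈ supportRadii K ω₀) (hR3 : R ≤ 1 / (3 * ε₀))
    (h : ∀ C ω : E n, InFamily ω₀ A K L ε₀ C ω →
      transDist (circProj C ω '' K) (circProj C ω '' L) < ε) {C : E n}
    (hC : IsOuterSupportBall K C (1 / ε₀) ∨ IsOuterSupportBall L C (1 / ε₀)) :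
    ∃ f : E n → E n, ∃ p : E n, ‖p‖ ≤ √(8 * R * ε) + ε ∧
      (∀ x ∈ K ∪ L, ‖f x - C‖ = ‖x - C‖) ∧
      (∀ x ∈ K, ∃ y ∈ L, ‖f x + p - f y‖ < ε) ∧ (∀ y ∈ L, ∃ x ∈ K, ‖f x + p - f y‖ < ε) := by
  obtain ⟨hR0, hKR⟩ := subset_closedBall_of_mem_supportRadii hω₀ hAK hR
  have hdK' : Metric.diam K ≤ 1 / ε₀ / 2 := hdK.trans_eq (by field_simp)
  have hdL' : Metric.diam L ≤ 1 / ε₀ / 2 := hdL.trans_eq (by field_simp)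
  have hR3' : 3 * R ≤ 1 / ε₀ := by
    have : 3 * (1 / (3 * ε₀)) = 1 / ε₀ := by field_simp
    linarith
  have hρ0 : 0 < 1 / ε₀ := by positivity
  have hAC : 1 / ε₀ ≤ ‖A - C‖ := by
    rcases hC with hC | hC
    · exact hC.le_norm_sub hK hAK.1
    · exact hC.le_norm_sub hL hAL.1
  have hACne : A ≠ C := fun h => by
    rw [h, sub_self, norm_zero] at hAC
    linarith
  obtain ⟨ω, hω, hω₀ω, hAω⟩ := exists_unit_orthogonal hn ω₀ (A - C)
  have hfA := circProj_eq_self hAω hACne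
  set ρ := 1 / ε₀ with hρ
  obtain ⟨p, hp1, hp2⟩ := exists_translation_of_transDist_lt
    (isBounded_circProj_image C hω hK.1.isBounded) (isBounded_circProj_image C hω hL.1.isBounded)
    (hK.2.1.image _) (hL.2.1.image _)
    (h C ω (inFamily_of_orthogonal hω hω₀ω hAω hACne hAK.1 hAL.1 hC))
  have hz : inner ℝ (A - R • ω₀ - C) ω = 0 := by
    rw [show A - R • ω₀ - C = (A - C) - R • ω₀ by abel, inner_sub_left, inner_smul_left, hAω,
      hω₀ω]
    simp
  have hzR : R < ‖A - R • ω₀ - C‖ := by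
    have h1 : ‖A - C‖ ≤ ‖A - R • ω₀ - C‖ + ‖R • ω₀‖ := by
      refine le_of_eq_of_le ?_ (norm_add_le _ _)
      congr 1
      abel
    rw [norm_smul, hω₀, mul_one, Real.norm_of_nonneg hR0] at h1
    linarith
  have hLA : ∀ y ∈ L, ‖(y - C) - (A - C)‖ ≤ ρ / 2 := by
    intro y hy
    rw [sub_sub_sub_cancel_right, ← dist_eq_norm]
    exact (dist_le_diam_of_mem hL.1.isBounded hy hAL.1).trans hdL'
  have hLpos : ∀ y ∈ L, 0 < inner ℝ (y - C) (A - C) := fun y hy =>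
    inner_pos_of_diam_le hL.1.isBounded hρ0 hdL' hAL.1 hAC hy
  refine ⟨circProj C ω, p, ?_, ?_, ?_, ?_⟩
  · have hpz : ‖p - R • ω₀‖ ≤ R + ε := by
      obtain ⟨_, ⟨k, hk, rfl⟩, hk'⟩ := hp2 _ (mem_image_of_mem _ hAL.1)
      rw [hfA] at hk'
      have h1 := circProj_mem_closedBall hω hz hzR (hKR hk)
      rw [mem_closedBall, dist_eq_norm] at h1
      calc ‖p - R • ω₀‖
          = ‖(circProj C ω k + p - A) - (circProj C ω k - (A - R • ω₀))‖ := by congr 1; abel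
        _ ≤ _ := (norm_sub_le _ _).trans (by linarith)
    obtain ⟨_, ⟨v, hv, rfl⟩, hv'⟩ := hp1 _ (mem_image_of_mem _ hAK.1)
    rw [hfA] at hv'
    obtain ⟨q, hq1, hq2, hq3⟩ := exists_translation_of_mem hn hε₀ hK hL hω₀ hAK hAL hR h hv
    obtain ⟨t, ht, hnorm, ht'⟩ :=
      exists_circProj_eq hω (sq_inner_lt_sq_norm hω hAω (hLpos v hv).ne')
    refine norm_bound_of_approx (a := A - C) (v := v - C) (F := circProj C ω v - C) (q := q)
      hω₀ hR0 hε ht hR3' hAC (hLA v hv) ?_ hnorm (ht' _ hAω) (ht' _ hω₀ω) ?_ hpz ?_ hq2 hq3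
    · rw [inner_sub_left, inner_sub_left, hAL.2]
      linarith [inner_le_supportFun hL.1 ω₀ hv]
    · rw [← norm_neg, show -(circProj C ω v - C - (A - C + p)) = A + p - circProj C ω v by abel]
      exact hv'.le
    · rwa [show v - C - (A - C + q) + R • ω₀ = v - (A + q) + R • ω₀ by abel]
  · rintro x (hx | hx)
    · exact norm_circProj_sub_of_diam_le hK.1.isBounded hρ0 hdK' hAK.1 hAC hω hAω hx
    · exact norm_circProj_sub_of_diam_le hL.1.isBounded hρ0 hdL' hAL.1 hAC hω hAω hx
  · intro x hx
    obtain ⟨_, ⟨y, hy, rfl⟩, h1⟩ := hp1 _ (mem_image_of_mem _ hx)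
    exact ⟨y, hy, h1⟩
  · intro y hy
    obtain ⟨_, ⟨x, hx, rfl⟩, h1⟩ := hp2 _ (mem_image_of_mem _ hy)
    exact ⟨x, hx, h1⟩

/-- The Hausdorff distance is bounded by the depth at which points of one body lie in outer support
balls of the other. -/
theorem hausdorffDist_le_of_depth {ε₀ : ℝ} (hε₀ : 0 < ε₀) {K L : Set (E n)}
    (hK : ClassK3 ε₀ K) (hL : ClassK3 ε₀ L) (hKL : hausdorffDist K L < 1 / (2 * ε₀)) {b : ℝ}
    (hb : 0 ≤ b)
    (h₁ : ∀ C, IsOuterSupportBall L C (1 / ε₀) → ∀ x ∈ K, ∀ d, ‖x - C‖ + d ≤ 1 / ε₀ → d ≤ b)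
    (h₂ : ∀ C, IsOuterSupportBall K C (1 / ε₀) → ∀ x ∈ L, ∀ d, ‖x - C‖ + d ≤ 1 / ε₀ → d ≤ b) :
    hausdorffDist K L ≤ b := by
  have hlt : 1 / (2 * ε₀) < 1 / ε₀ := by
    gcongr
    linarith
  have hfin : hausdorffEDist K L ≠ ⊤ := hausdorffEDist_ne_top_of_nonempty_of_bounded hK.1.2.1
    hL.1.2.1 hK.1.1.isBounded hL.1.1.isBounded
  refine hausdorffDist_le_of_infDist hb (fun x hx => ?_) (fun x hx => ?_)
  · rcases (infDist_nonneg (x := x) (s := L)).eq_or_lt with h0 | h0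
    · rwa [← h0]
    obtain ⟨C, hC, hd⟩ := hL.exists_center h0
      ((infDist_le_hausdorffDist_of_mem hx hfin).trans_lt (hKL.trans hlt))
    exact h₁ C hC x hx _ hd
  · rcases (infDist_nonneg (x := x) (s := K)).eq_or_lt with h0 | h0
    · rwa [← h0]
    rw [hausdorffEDist_comm] at hfin
    rw [hausdorffDist_comm] at hKL
    obtain ⟨C, hC, hd⟩ := hK.exists_center h0
      ((infDist_le_hausdorffDist_of_mem hx hfin).trans_lt (hKL.trans hlt))
    exact h₂ C hC x hx _ hd

/-- Points of one body at depth `d` in an outer support ball of the other are still at that depth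
after the projection, so `d` is at most the length of the translation plus the tolerance. -/
theorem hausdorffDist_le_of_transDist_lt (hn : 2 < n) {ε₀ : ℝ} (hε₀ : 0 < ε₀) {K L : Set (E n)}
    (hK : ClassK3 ε₀ K) (hL : ClassK3 ε₀ L) (hdK : Metric.diam K ≤ 1 / (2 * ε₀))
    (hdL : Metric.diam L ≤ 1 / (2 * ε₀))
    (hKL : hausdorffDist K L < 1 / (2 * ε₀)) {ω₀ A : E n}
    (hω₀ : ‖ω₀‖ = 1) (hAK : A ∈ supportSet K ω₀) (hAL : A ∈ supportSet L ω₀) {R ε : ℝ}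
    (hε : 0 ≤ ε) (hR : R ∈ supportRadii K ω₀) (hR3 : R ≤ 1 / (3 * ε₀))
    (h : ∀ C ω : E n, InFamily ω₀ A K L ε₀ C ω →
      transDist (circProj C ω '' K) (circProj C ω '' L) < ε) :
    hausdorffDist K L ≤ √(8 * R * ε) + 2 * ε := by
  refine hausdorffDist_le_of_depth hε₀ hK hL hKL (by positivity) (fun C hC x hx d hd => ?_)
    (fun C hC x hx d hd => ?_)
  · obtain ⟨f, p, hp, hf, h1, -⟩ := exists_short_translation hn hε₀ hK.1 hL.1 hdK hdL hω₀ hAK hAL hε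
      hR hR3 h (Or.inr hC)
    obtain ⟨y, hy, hxy⟩ := h1 x hx
    have h2 := hC.le_norm_sub hL.1 hy
    have h3 : ‖f y - C‖ ≤ ‖f x - C‖ + ‖p‖ + ‖f x + p - f y‖ := by
      calc ‖f y - C‖ = ‖(f x - C) + p - (f x + p - f y)‖ := by congr 1; abel
        _ ≤ _ := (norm_sub_le _ _).trans (by gcongr; exact norm_add_le _ _)
    rw [hf x (Or.inl hx), hf y (Or.inr hy)] at h3
    linarith
  · obtain ⟨f, p, hp, hf, -, h1⟩ := exists_short_translation hn hε₀ hK.1 hL.1 hdK hdL hω₀ hAK hAL hε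
      hR hR3 h (Or.inl hC)
    obtain ⟨y, hy, hxy⟩ := h1 x hx
    have h2 := hC.le_norm_sub hK.1 hy
    have h3 : ‖f y - C‖ ≤ ‖f x - C‖ + ‖p‖ + ‖f y + p - f x‖ := by
      calc ‖f y - C‖ = ‖(f x - C) - p + (f y + p - f x)‖ := by congr 1; abel
        _ ≤ _ := (norm_add_le _ _).trans (by gcongr; exact norm_sub_le _ _)
    rw [hf x (Or.inr hx), hf y (Or.inl hy)] at h3
    linarith

/-! ### Bounds for the Hausdorff distance from rotations -/

/-- Rotations about `C` and circular projections with centre `C` preserve the distance to `C`, so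
a point of one body that lies at depth `d` in a ball missing the other body stays at distance at
least `d` from the image of that body: no loss occurs beyond `ε`. -/
theorem hausdorffDist_le_of_rotDist_le (hn : 2 < n) {ε₀ : ℝ} (hε₀ : 0 < ε₀) {K L : Set (E n)}
    (hK : ClassK3 ε₀ K) (hL : ClassK3 ε₀ L) (hdK : Metric.diam K ≤ 1 / (2 * ε₀))
    (hdL : Metric.diam L ≤ 1 / (2 * ε₀)) (hKL : hausdorffDist K L < 1 / (2 * ε₀)) {ω₀ A : E n}
    (hAK : A ∈ K) (hAL : A ∈ L) {ε : ℝ} (hε : 0 ≤ ε)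
    (h : ∀ C ω : E n, InFamily ω₀ A K L ε₀ C ω →
      rotDist C (circProj C ω '' K) (circProj C ω '' L) ≤ ε) :
    hausdorffDist K L ≤ ε := by
  have hρ0 : 0 < 1 / ε₀ := by positivity
  have hdK' : Metric.diam K ≤ 1 / ε₀ / 2 := hdK.trans_eq (by field_simp)
  have hdL' : Metric.diam L ≤ 1 / ε₀ / 2 := hdL.trans_eq (by field_simp)
  have key : ∀ C, IsOuterSupportBall K C (1 / ε₀) ∨ IsOuterSupportBall L C (1 / ε₀) →
      ∀ δ > ε, (∀ x ∈ K, ∃ y ∈ L, ‖y - C‖ < ‖x - C‖ + δ) ∧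
        ∀ y ∈ L, ∃ x ∈ K, ‖x - C‖ < ‖y - C‖ + δ := by
    intro C hC δ hδ
    have hAC : 1 / ε₀ ≤ ‖A - C‖ := by
      rcases hC with hC | hC
      · exact hC.le_norm_sub hK.1 hAK
      · exact hC.le_norm_sub hL.1 hAL
    have hACne : A ≠ C := fun h => by
      rw [h, sub_self, norm_zero] at hAC
      linarith
    obtain ⟨ω, hω, hω₀ω, hAω⟩ := exists_unit_orthogonal hn ω₀ (A - C)
    obtain ⟨g, hg1, hg2⟩ := exists_isometry_of_rotDist_lt hn.le
      (isBounded_circProj_image C hω hK.1.1.isBounded)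
      (isBounded_circProj_image C hω hL.1.1.isBounded) (hK.1.2.1.image _) (hL.1.2.1.image _)
      ((h C ω (inFamily_of_orthogonal hω hω₀ω hAω hACne hAK hAL hC)).trans_lt hδ)
    have hfK : ∀ x ∈ K, ‖circProj C ω x - C‖ = ‖x - C‖ := fun x hx =>
      norm_circProj_sub_of_diam_le hK.1.1.isBounded hρ0 hdK' hAK hAC hω hAω hx
    have hfL : ∀ x ∈ L, ‖circProj C ω x - C‖ = ‖x - C‖ := fun x hx =>
      norm_circProj_sub_of_diam_le hL.1.1.isBounded hρ0 hdL' hAL hAC hω hAω hx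
    -- `g` preserves the distance to `C`
    have hdist : ∀ x ∈ K, ∀ y ∈ L, ‖C + g (circProj C ω x - C) - circProj C ω y‖ < δ →
        |‖x - C‖ - ‖y - C‖| < δ := by
      intro x hx y hy hxy
      have h1 := abs_norm_sub_norm_le (g (circProj C ω x - C)) (circProj C ω y - C)
      rw [g.norm_map, hfK x hx, hfL y hy] at h1
      rw [show g (circProj C ω x - C) - (circProj C ω y - C)
        = C + g (circProj C ω x - C) - circProj C ω y by abel] at h1
      exact h1.trans_lt hxy
    constructor
    · intro x hx
      obtain ⟨_, ⟨y, hy, rfl⟩, hxy⟩ := hg1 _ (mem_image_of_mem _ hx)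
      exact ⟨y, hy, by linarith [(abs_lt.1 (hdist x hx y hy hxy)).1]⟩
    · intro y hy
      obtain ⟨_, ⟨x, hx, rfl⟩, hxy⟩ := hg2 _ (mem_image_of_mem _ hy)
      exact ⟨x, hx, by linarith [(abs_lt.1 (hdist x hx y hy hxy)).2]⟩
  refine hausdorffDist_le_of_depth hε₀ hK hL hKL hε (fun C hC x hx d hd => ?_)
    (fun C hC x hx d hd => ?_)
  · refine le_of_forall_gt_imp_ge_of_dense fun δ hδ => ?_
    obtain ⟨y, hy, hxy⟩ := (key C (Or.inr hC) δ hδ).1 x hx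
    linarith [hC.le_norm_sub hL.1 hy]
  · refine le_of_forall_gt_imp_ge_of_dense fun δ hδ => ?_
    obtain ⟨y, hy, hxy⟩ := (key C (Or.inl hC) δ hδ).2 x hx
    linarith [hC.le_norm_sub hK.1 hy]

/-! ### The radius and the correction term relative to a centre -/

theorem relRadius_pos {M : Set (E n)} (hM : Bornology.IsBounded M) (hM' : M.Nontrivial) (ε₀ : ℝ)
    (C : E n) : 0 < relRadius ε₀ M C := by
  obtain ⟨x, hx, y, hy, hxy⟩ := hM'
  have h0 : 0 < dist x y / 2 := half_pos (dist_pos.2 hxy)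
  have hne : {s : ℝ | M ⊆ closedBall C (1 / ε₀ + s)}.Nonempty := by
    obtain ⟨r, hr⟩ := hM.subset_closedBall C
    exact ⟨r - 1 / ε₀, by simpa using hr⟩
  have hsub : M ⊆ closedBall C (1 / ε₀ + relHeight ε₀ M C) := by
    intro u hu
    have : dist u C - 1 / ε₀ ≤ relHeight ε₀ M C := by
      refine le_csInf hne fun s hs => ?_
      have := mem_closedBall.1 (hs hu)
      linarith
    rw [mem_closedBall]
    linarith
  refine h0.trans_le (le_csInf ⟨_, C, hsub, Subset.rfl⟩ ?_)
  rintro R ⟨z, hz, -⟩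
  have h1 := mem_closedBall.1 (hz hx)
  have h2 := mem_closedBall.1 (hz hy)
  linarith [dist_triangle_right x y z]

/-- The points of the axis, where the projection has the junk value `C`, cannot make the image a
single point: then `K` would lie on a sphere. -/
theorem nontrivial_circProj_image (hn : 0 < n) {K : Set (E n)} (hK : IsBody K) {C ω : E n}
    (hω : ‖ω‖ = 1) (hP : (puncturedPlane C ω ∩ K).Nonempty) : (circProj C ω '' K).Nontrivial := by
  obtain ⟨y, ⟨hyω, hyC⟩, hyK⟩ := hP
  by_contra hns
  rw [Set.not_nontrivial_iff] at hns
  have hfy := circProj_eq_self hyω hyC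
  have hsph : K ⊆ sphere C ‖y - C‖ := by
    intro x hx
    have hxy : circProj C ω x = y := by
      rw [← hfy]
      exact hns (mem_image_of_mem _ hx) (by rw [hfy]; exact ⟨y, hyK, hfy⟩)
    rw [mem_sphere, dist_eq_norm]
    rcases circProj_eq_center_or_norm C hω x with h | h
    · exact absurd (hxy.symm.trans h) hyC
    · rw [← h, hxy]
  have : Nonempty (Fin n) := ⟨⟨0, hn⟩⟩
  have hint : interior K = ∅ := by
    refine subset_empty_iff.1 ((interior_mono hsph).trans ?_)
    rw [interior_sphere' C ‖y - C‖]
  have h := hK.2.2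
  rw [hint, closure_empty] at h
  exact hK.2.1.ne_empty h.symm

theorem epsTilde_nonneg {ε₀ ε : ℝ} {M : Set (E n)} {C : E n} (h : ε ≤ relRadius ε₀ M C) :
    0 ≤ epsTilde ε₀ ε M C := by
  have h1 : 0 ≤ relRadius ε₀ M C - ε := sub_nonneg.2 h
  have h2 : 0 ≤ relAlpha ε₀ M C := Real.sqrt_nonneg _
  unfold epsTilde
  positivity

/-- `ε̃ = u + u² / (4√R)` with `u = (R - ε) α`, a quadratic polynomial in `u` whose least value is
`-√R`. -/
theorem neg_sqrt_relRadius_le_epsTilde {ε₀ ε : ℝ} {M : Set (E n)} {C : E n}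
    (h : 0 < relRadius ε₀ M C) : -√(relRadius ε₀ M C) ≤ epsTilde ε₀ ε M C := by
  have hs := Real.sqrt_pos.2 h
  have h1 : epsTilde ε₀ ε M C + √(relRadius ε₀ M C) =
      ((relRadius ε₀ M C - ε) * relAlpha ε₀ M C + 2 * √(relRadius ε₀ M C)) ^ 2 /
        (4 * √(relRadius ε₀ M C)) := by
    rw [epsTilde]
    field_simp
    ring
  have h2 : 0 ≤ ((relRadius ε₀ M C - ε) * relAlpha ε₀ M C + 2 * √(relRadius ε₀ M C)) ^ 2 /
        (4 * √(relRadius ε₀ M C)) := by positivity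
  linarith

theorem neg_sqrt_le_epsTilde {ε₀ ε : ℝ} {M : Set (E n)} {C : E n}
    (h : 0 < relRadius ε₀ M C) : -√ε ≤ epsTilde ε₀ ε M C := by
  rcases le_total ε (relRadius ε₀ M C) with h1 | h1
  · exact (neg_nonpos.2 (Real.sqrt_nonneg ε)).trans (epsTilde_nonneg h1)
  · exact (neg_le_neg (Real.sqrt_le_sqrt h1)).trans (neg_sqrt_relRadius_le_epsTilde h)

end EpsConvex

theorem theorem7 (n : ℕ) (hn : 2 < n) (ε₀ : ℝ) (hε₀ : 0 < ε₀)
    (K L : Set (EpsConvex.E n))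
    (hK : EpsConvex.ClassK3 ε₀ K) (hL : EpsConvex.ClassK3 ε₀ L)
    (hdK : Metric.diam K < 1 / (2 * ε₀)) (hdL : Metric.diam L < 1 / (2 * ε₀))
    (hKL : Metric.hausdorffDist K L < 1 / (2 * ε₀))
    (ω₀ A : EpsConvex.E n) (hω₀ : ‖ω₀‖ = 1)
    (hRfin : (EpsConvex.supportRadii K ω₀).Nonempty)
    (hR : EpsConvex.supportRadius K ω₀ < 1 / (3 * ε₀))
    (hAK : EpsConvex.supportSet K ω₀ = {A}) (hAL : A ∈ EpsConvex.supportSet L ω₀)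
    (ε : ℝ) (hε : 0 ≤ ε) :
    ((∀ C ω : EpsConvex.E n, EpsConvex.InFamily ω₀ A K L ε₀ C ω →
        EpsConvex.transDist (EpsConvex.circProj C ω '' K) (EpsConvex.circProj C ω '' L) ≤ ε) →
      EpsConvex.transDist K L ≤
        2 * (Real.sqrt (2 * EpsConvex.supportRadius K ω₀) + Real.sqrt ε) * Real.sqrt ε) ∧
    ((∀ C ω : EpsConvex.E n, EpsConvex.InFamily ω₀ A K L ε₀ C ω →
        EpsConvex.rotDist C (EpsConvex.circProj C ω '' K) (EpsConvex.circProj C ω '' L) ≤ ε) →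
      ∀ C ω : EpsConvex.E n, EpsConvex.InFamily ω₀ A K L ε₀ C ω →
        ∀ M : Set (EpsConvex.E n), (M = K ∨ M = EpsConvex.circProj C ω '' K) →
          EpsConvex.rotDist C K L ≤
            (Real.sqrt (8 * EpsConvex.relRadius ε₀ K C) + 3 * Real.sqrt ε
              + EpsConvex.epsTilde ε₀ ε M C) * Real.sqrt ε ∧
          (0 ≤ EpsConvex.epsTilde ε₀ ε M C →
            EpsConvex.rotDist C K L ≤
              (Real.sqrt (8 * EpsConvex.relRadius ε₀ K C)
                + 3 * Real.sqrt (ε + EpsConvex.epsTilde ε₀ ε M C)) * Real.sqrt ε)) := by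
  have hA : A ∈ EpsConvex.supportSet K ω₀ := by rw [hAK]; rfl
  have hsq : √ε * √ε = ε := Real.mul_self_sqrt hε
  have hs0 : 0 ≤ √ε := Real.sqrt_nonneg ε
  refine ⟨fun h => (EpsConvex.transDist_le_hausdorffDist K L).trans ?_, fun h C ω hCω M hM => ?_⟩
  -- The bound holds for every radius in `supportRadii K ω₀` and every tolerance above `ε`, so that
  -- neither infimum has to be attained; the limit of both gives the claim.
  · have hR0 : 0 ≤ EpsConvex.supportRadius K ω₀ := le_csInf hRfin fun R hR =>
      (EpsConvex.subset_closedBall_of_mem_supportRadii hω₀ hA hR).1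
    have hev : ∀ᶠ δ in nhdsWithin (0 : ℝ) (Set.Ioi 0), hausdorffDist K L ≤
        √(8 * (EpsConvex.supportRadius K ω₀ + δ) * (ε + δ)) + 2 * (ε + δ) := by
      filter_upwards [self_mem_nhdsWithin] with δ hδ
      have hδ : 0 < δ := hδ
      obtain ⟨R, hRm, hRlt⟩ := exists_lt_of_csInf_lt hRfin
        (lt_min (lt_add_of_pos_right (EpsConvex.supportRadius K ω₀) hδ) hR)
      obtain ⟨hR1, hR2⟩ := lt_min_iff.1 hRlt
      refine (EpsConvex.hausdorffDist_le_of_transDist_lt hn hε₀ hK hL hdK.le hdL.le hKL hω₀ hA hAL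
        (by positivity : 0 ≤ ε + δ) hRm hR2.le
        fun C ω hCω => (h C ω hCω).trans_lt (by linarith)).trans ?_
      gcongr
    have hcont : Continuous fun δ : ℝ =>
        √(8 * (EpsConvex.supportRadius K ω₀ + δ) * (ε + δ)) + 2 * (ε + δ) := by fun_prop
    have hlim := ge_of_tendsto ((hcont.tendsto 0).mono_left nhdsWithin_le_nhds) hev
    refine hlim.trans_eq ?_
    have h8 : √(8 * EpsConvex.supportRadius K ω₀ * ε)
        = 2 * √(2 * EpsConvex.supportRadius K ω₀) * √ε := by
      rw [Real.sqrt_mul (by positivity),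
        show 8 * EpsConvex.supportRadius K ω₀ = 2 ^ 2 * (2 * EpsConvex.supportRadius K ω₀) by ring,
        Real.sqrt_mul (by positivity), Real.sqrt_sq (by positivity)]
    rw [add_zero, add_zero, h8]
    linear_combination -2 * hsq
  -- The Hausdorff distance is at most `ε`, and both bounds are at least `ε` because `ε̃ ≥ -√ε`.
  · have hd : EpsConvex.rotDist C K L ≤ ε :=
      (EpsConvex.rotDist_le_hausdorffDist hn.le C K L).trans
        (EpsConvex.hausdorffDist_le_of_rotDist_le hn hε₀ hK hL hdK.le hdL.le hKL hA.1 hAL.1 hε h)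
    have hω : ‖ω‖ = 1 := hCω.1.1
    have hnt := EpsConvex.nontrivial_circProj_image (by omega) hK.1 hω hCω.2.2.1
    have hpos : 0 < EpsConvex.relRadius ε₀ M C := by
      rcases hM with rfl | rfl
      · exact EpsConvex.relRadius_pos hK.1.1.isBounded (Set.nontrivial_of_image _ _ hnt) ε₀ C
      · exact EpsConvex.relRadius_pos
          (EpsConvex.isBounded_circProj_image C hω hK.1.1.isBounded) hnt ε₀ C
    have h8 := Real.sqrt_nonneg (8 * EpsConvex.relRadius ε₀ K C)
    refine ⟨hd.trans ?_, fun h0 => hd.trans ?_⟩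
    · have h1 := EpsConvex.neg_sqrt_le_epsTilde (ε := ε) hpos
      calc ε = √ε * √ε := hsq.symm
        _ ≤ _ := by
          gcongr
          linarith
    · have h1 : √ε ≤ √(ε + EpsConvex.epsTilde ε₀ ε M C) := Real.sqrt_le_sqrt (by linarith)
      calc ε = √ε * √ε := hsq.symm
        _ ≤ _ := by
          gcongr
          linarith
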